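/- Let $A\in\mathbb{R}^{m\times n}$ have full column rank, $b\in\mathbb{R}^m$, and let $x_{ls}=\arg\min_x\|Ax-b\|$, $r_{ls}=Ax_{ls}-b$ (Euclidean norms). Let $\theta\in[0,\infty]$. For $0\neq\bar x\in\mathbb{R}^n$ put $\bar r=A\bar x-b$, $\gamma=\|\bar r\|/\|\bar x\|$, $$\mu=\frac{\theta^2\|\bar x\|^2}{1+\theta^2\|\bar x\|^2}\quad(\mu=1\text{ if }\theta=\infty),\qquad \lambda_*=\lambda_{\min}\left(AA^T-\mu\frac{\bar r\bar r^T}{\|\bar x\|^2}\right),$$ where $\lambda_{\min}$ denotes the smallest eigenvalue, and define the normwise backward error $$\eta_F(\bar x)=\min\left\{\|(E,\theta e)\|_F \;:\; E\in\mathbb{R}^{m\times n},\ e\in\mathbb{R}^m,\ \bar x\text{ is a minimizer of } x\mapsto\|(A+E)x-(b+e)\|\right\},$$ where for $\theta=\infty$ only perturbations with $e=0$ are admitted and their size is $\|E\|_F$. (i) If $r_{ls}\neq0$, then for every $\bar x\ne 0$ the minimum defining $\eta_F(\bar x)$ is attained, $$\eta_F(\bar x)=(\gamma^2\mu+\lambda_*)^{1/2},\qquad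 \eta_F(\bar x)\le\frac{\|A^T\bar r\|}{\|\bar r\|},$$ and, if moreover $\theta>0$, then $\lambda_*<0$. (ii) If $r_{ls}=0$, there is $\delta>0$ such that for every $\bar x\neq0$ with $\|\bar x-x_{ls}\|<\delta$ one has $\lambda_*\ge0$, the minimum defining $\eta_F(\bar x)$ is attained, and $\eta_F(\bar x)=\gamma\sqrt{\mu}$. -/

import Mathlib

open scoped ENNReal Matrix

noncomputable section

namespace LeastSquares

variable {m n : ℕ}

/-- The residual `A x - b`. -/
def residual (A : Matrix (Fin m) (Fin n) ℝ) (b : EuclideanSpace ℝ (Fin m))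
    (x : EuclideanSpace ℝ (Fin n)) : EuclideanSpace ℝ (Fin m) :=
  WithLp.toLp 2 (A *ᵥ WithLp.ofLp x) - b

/-- `x` solves the least squares problem `min_z ‖A z - b‖` (Euclidean norm). -/
def IsSolution (A : Matrix (Fin m) (Fin n) ℝ) (b : EuclideanSpace ℝ (Fin m))
    (x : EuclideanSpace ℝ (Fin n)) : Prop :=
  ∀ z : EuclideanSpace ℝ (Fin n), ‖residual A b x‖ ≤ ‖residual A b z‖

section
attribute [local instance] Matrix.frobeniusNormedAddCommGroup

/-- The Frobenius norm `‖(E, t e)‖_F` of the `m × (n + 1)` matrix with blocks `E` and `t e`. -/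
def augFrobeniusNorm (t : ℝ) (E : Matrix (Fin m) (Fin n) ℝ) (e : EuclideanSpace ℝ (Fin m)) : ℝ :=
  ‖Matrix.fromCols E (Matrix.replicateCol (Fin 1) (WithLp.ofLp (t • e)))‖

end

/-- The sizes `‖(E, θ e)‖_F` of all perturbations `(E, e)` for which `x` solves
`min_z ‖(A + E) z - (b + e)‖`.  The value `θ = ∞` means that only `A` may be perturbed: then
`e = 0` is required and the size is `‖E‖_F`. -/
def backwardErrors (θ : ℝ≥0∞) (A : Matrix (Fin m) (Fin n) ℝ) (b : EuclideanSpace ℝ (Fin m))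
    (x : EuclideanSpace ℝ (Fin n)) : Set ℝ :=
  {s | ∃ (E : Matrix (Fin m) (Fin n) ℝ) (e : EuclideanSpace ℝ (Fin m)),
    (θ = ∞ → e = 0) ∧ IsSolution (A + E) (b + e) x ∧ s = augFrobeniusNorm θ.toReal E e}

/-- The normwise backward error `η_F(x)`. -/
def eta (θ : ℝ≥0∞) (A : Matrix (Fin m) (Fin n) ℝ) (b : EuclideanSpace ℝ (Fin m))
    (x : EuclideanSpace ℝ (Fin n)) : ℝ :=
  sInf (backwardErrors θ A b x)

/-- `γ = ‖A x - b‖ / ‖x‖`. -/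
def gamma (A : Matrix (Fin m) (Fin n) ℝ) (b : EuclideanSpace ℝ (Fin m))
    (x : EuclideanSpace ℝ (Fin n)) : ℝ :=
  ‖residual A b x‖ / ‖x‖

/-- `μ = θ² ‖x‖² / (1 + θ² ‖x‖²)`, and `μ = 1` for `θ = ∞`. -/
def mu (θ : ℝ≥0∞) (x : EuclideanSpace ℝ (Fin n)) : ℝ :=
  if θ = ∞ then 1 else θ.toReal ^ 2 * ‖x‖ ^ 2 / (1 + θ.toReal ^ 2 * ‖x‖ ^ 2)

/-- The smallest eigenvalue of a symmetric real matrix of positive size. -/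
def lambdaMin (M : Matrix (Fin m) (Fin m) ℝ) : ℝ :=
  sInf {t : ℝ | Module.End.HasEigenvalue (Matrix.toLin' M) t}

/-- `λ_* = λ_min (A Aᵀ - μ r rᵀ / ‖x‖²)` with `r = A x - b`. -/
def lambdaStar (θ : ℝ≥0∞) (A : Matrix (Fin m) (Fin n) ℝ) (b : EuclideanSpace ℝ (Fin m))
    (x : EuclideanSpace ℝ (Fin n)) : ℝ :=
  lambdaMin (A * Aᵀ - (mu θ x / ‖x‖ ^ 2) •
    Matrix.vecMulVec (WithLp.ofLp (residual A b x)) (WithLp.ofLp (residual A b x)))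

end LeastSquares

end

/-!
Put `r = A x - b`. Among the perturbations `(E, e)` with prescribed `E x - e = d`, the one of least
size is `E = c d xᵀ`, `e = -(1 - μ) d` with `c = μ / ‖x‖²`, and its size is `√c ‖d‖`. Let `(E, e)`
make `x` a minimizer, with perturbed residual `s`, and let `v` be the unit vector along `s` (`v = 0`
if `s = 0`). The normal equations force `vᵀ E = -vᵀ A`, while `1 - v vᵀ` annihilates
`s = r + (E x - e)`, so Pythagoras gives

  `‖(E, θ e)‖² ≥ c ‖(1 - v vᵀ) r‖² + ‖vᵀ A‖² = γ² μ + vᵀ (A Aᵀ - c r rᵀ) v`,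

and for every such `v` some `(E, e)` attains equality. Minimizing the quadratic form over the unit
sphere and `0` yields `η² = γ² μ + min (λ_*, 0)`. The sign of `λ_*` is decided by two estimates: at
`r_ls` the form equals `-c ‖r_ls‖⁴`, whereas for `r_ls = 0` one has `vᵀ r = vᵀ A (x - x_ls)`, and
Cauchy–Schwarz makes the form nonnegative as soon as `‖x - x_ls‖ ≤ ‖x‖`. Testing the form at `r`
gives the upper bound for `η`.
-/

namespace LeastSquares

section DotProduct

variable {ι κ : Type*} [Fintype ι]

lemma norm_sq_eq_dotProduct (x : EuclideanSpace ℝ ι) : ‖x‖ ^ 2 = x.ofLp ⬝ᵥ x.ofLp := by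
  rw [EuclideanSpace.real_norm_sq_eq]
  simp only [dotProduct, sq]

lemma inner_eq_dotProduct (x y : EuclideanSpace ℝ ι) : inner ℝ x y = x.ofLp ⬝ᵥ y.ofLp := by
  rw [EuclideanSpace.inner_eq_star_dotProduct, star_trivial, dotProduct_comm]

lemma sq_dotProduct_le (u v : ι → ℝ) : (u ⬝ᵥ v) ^ 2 ≤ (u ⬝ᵥ u) * (v ⬝ᵥ v) := by
  simpa only [dotProduct, sq] using Finset.sum_mul_sq_le_sq_mul_sq Finset.univ u v

lemma exists_smul_dotProduct_self_eq_one {v : ι → ℝ} (hv : v ≠ 0) :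
    ∃ k : ℝ, (k • v) ⬝ᵥ (k • v) = 1 := by
  have hpos : 0 < v ⬝ᵥ v := Matrix.dotProduct_star_self_pos_iff.2 hv
  refine ⟨(√(v ⬝ᵥ v))⁻¹, ?_⟩
  rw [smul_dotProduct, dotProduct_smul, smul_smul, ← mul_inv, Real.mul_self_sqrt hpos.le,
    smul_eq_mul, inv_mul_cancel₀ hpos.ne']

lemma vecMul_vecMulVec_vecMul {v : ι → ℝ} (hv : v = 0 ∨ v ⬝ᵥ v = 1) (A : Matrix ι κ ℝ) :
    v ᵥ* Matrix.vecMulVec v (v ᵥ* A) = v ᵥ* A := by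
  rw [Matrix.vecMul_vecMulVec]
  rcases hv with rfl | hv
  · rw [Matrix.zero_vecMul, smul_zero]
  · rw [hv, one_smul]

variable [DecidableEq ι]

/-- The matrix `1 - v vᵀ`: for a unit vector `v` the orthogonal projection onto `v⊥`, for `v = 0`
the identity. -/
noncomputable def deflation (v : ι → ℝ) : Matrix ι ι ℝ := 1 - Matrix.vecMulVec v v

lemma deflation_mulVec (v u : ι → ℝ) : deflation v *ᵥ u = u - (v ⬝ᵥ u) • v := by
  rw [deflation, Matrix.sub_mulVec, Matrix.one_mulVec, Matrix.vecMulVec_mulVec, op_smul_eq_smul]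

variable {v : ι → ℝ}

lemma deflation_mulVec_self (hv : v = 0 ∨ v ⬝ᵥ v = 1) : deflation v *ᵥ v = 0 := by
  rcases hv with rfl | hv
  · exact Matrix.mulVec_zero _
  · rw [deflation_mulVec, hv, one_smul, sub_self]

lemma dotProduct_deflation_mulVec (hv : v = 0 ∨ v ⬝ᵥ v = 1) (u : ι → ℝ) :
    v ⬝ᵥ (deflation v *ᵥ u) = 0 := by
  rcases hv with rfl | hv
  · exact zero_dotProduct _
  · rw [deflation_mulVec, dotProduct_sub, dotProduct_smul, hv, smul_eq_mul, mul_one, sub_self]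

lemma deflation_mulVec_dotProduct_self (hv : v = 0 ∨ v ⬝ᵥ v = 1) (u : ι → ℝ) :
    (deflation v *ᵥ u) ⬝ᵥ (deflation v *ᵥ u) = u ⬝ᵥ u - (v ⬝ᵥ u) ^ 2 := by
  nth_rewrite 1 [deflation_mulVec]
  rw [sub_dotProduct, smul_dotProduct, dotProduct_deflation_mulVec hv, deflation_mulVec,
    dotProduct_sub, dotProduct_smul, dotProduct_comm u v, smul_zero, sub_zero, smul_eq_mul, sq]

lemma sum_dotProduct_self_deflation_mul [Fintype κ] (hv : v = 0 ∨ v ⬝ᵥ v = 1)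
    (E : Matrix ι κ ℝ) :
    ∑ i, (deflation v * E) i ⬝ᵥ (deflation v * E) i
      = ∑ i, E i ⬝ᵥ E i - (v ᵥ* E) ⬝ᵥ (v ᵥ* E) := by
  have sum_rows_eq_sum_cols (F : Matrix ι κ ℝ) : ∑ i, F i ⬝ᵥ F i = ∑ j, F.col j ⬝ᵥ F.col j :=
    Finset.sum_comm
  calc ∑ i, (deflation v * E) i ⬝ᵥ (deflation v * E) i
      = ∑ j, (deflation v *ᵥ E.col j) ⬝ᵥ (deflation v *ᵥ E.col j) := sum_rows_eq_sum_cols _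
    _ = ∑ j, E.col j ⬝ᵥ E.col j - ∑ j, (v ⬝ᵥ E.col j) ^ 2 := by
      simp only [deflation_mulVec_dotProduct_self hv, Finset.sum_sub_distrib]
    _ = ∑ i, E i ⬝ᵥ E i - (v ᵥ* E) ⬝ᵥ (v ᵥ* E) := by
      simp only [sum_rows_eq_sum_cols, sq]
      rfl

lemma exists_deflation_mulVec_eq_zero (s : ι → ℝ) :
    ∃ k : ℝ, (k • s = 0 ∨ (k • s) ⬝ᵥ (k • s) = 1) ∧ deflation (k • s) *ᵥ s = 0 := by
  rcases eq_or_ne s 0 with rfl | hs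
  · exact ⟨0, .inl (zero_smul ℝ 0), Matrix.mulVec_zero _⟩
  · obtain ⟨k, hk⟩ := exists_smul_dotProduct_self_eq_one hs
    have hk0 : k ≠ 0 := by
      rintro rfl
      simp at hk
    refine ⟨k, .inr hk, ?_⟩
    have h := deflation_mulVec_self (.inr hk)
    rw [Matrix.mulVec_smul] at h
    exact (smul_eq_zero.1 h).resolve_left hk0

end DotProduct

section SmallestEigenvalue

variable {m : ℕ} {M : Matrix (Fin m) (Fin m) ℝ}

lemma lambdaMin_eq_sInf_spectrum (M : Matrix (Fin m) (Fin m) ℝ) :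
    lambdaMin M = sInf (spectrum ℝ M) := by
  simp only [lambdaMin, Module.End.hasEigenvalue_iff_mem_spectrum, Matrix.spectrum_toLin',
    Set.ofPred_mem_eq]

lemma lambdaMin_mul_dotProduct_self_le (hM : M.IsHermitian) (v : Fin m → ℝ) :
    lambdaMin M * (v ⬝ᵥ v) ≤ v ⬝ᵥ M *ᵥ v := by
  have hshift : (M - algebraMap ℝ _ (lambdaMin M)).PosSemidef := by
    refine Matrix.posSemidef_iff_isHermitian_and_spectrum_nonneg.2
      ⟨(hM.isSelfAdjoint.sub (.algebraMap _ (.all _))).isHermitian, ?_⟩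
    rw [← spectrum.sub_singleton_eq, lambdaMin_eq_sInf_spectrum]
    rintro _ ⟨t, ht, _, rfl, rfl⟩
    exact sub_nonneg.2 (csInf_le Matrix.finite_real_spectrum.bddBelow ht)
  have h := hshift.dotProduct_mulVec_nonneg v
  rw [star_trivial, Matrix.sub_mulVec, dotProduct_sub, Algebra.algebraMap_eq_smul_one,
    Matrix.smul_mulVec, Matrix.one_mulVec, dotProduct_smul, smul_eq_mul] at h
  linarith

lemma exists_dotProduct_mulVec_eq_lambdaMin [NeZero m] (hM : M.IsHermitian) :
    ∃ v : Fin m → ℝ, v ⬝ᵥ v = 1 ∧ v ⬝ᵥ M *ᵥ v = lambdaMin M := by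
  have hmem : lambdaMin M ∈ spectrum ℝ M := by
    rw [lambdaMin_eq_sInf_spectrum]
    exact Set.Nonempty.csInf_mem ⟨_, hM.eigenvalues_mem_spectrum_real 0⟩
      Matrix.finite_real_spectrum
  rw [← Matrix.spectrum_toLin', ← Module.End.hasEigenvalue_iff_mem_spectrum] at hmem
  obtain ⟨u, hu⟩ := hmem.exists_hasEigenvector
  obtain ⟨k, hk⟩ := exists_smul_dotProduct_self_eq_one hu.2
  have hMu : M *ᵥ u = lambdaMin M • u := hu.apply_eq_smul
  refine ⟨k • u, hk, ?_⟩
  rw [Matrix.mulVec_smul, hMu, smul_comm, dotProduct_smul, hk, smul_eq_mul, mul_one]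

end SmallestEigenvalue

lemma exists_pos_forall_norm_sub_le_norm {V : Type*} [SeminormedAddCommGroup V] (a : V) :
    ∃ δ : ℝ, 0 < δ ∧ ∀ x : V, ‖x - a‖ < δ → ‖x - a‖ ≤ ‖x‖ := by
  rcases (norm_nonneg a).eq_or_lt with ha | ha
  · exact ⟨1, one_pos, fun x _ => by linarith [norm_sub_le x a]⟩
  · refine ⟨‖a‖ / 2, half_pos ha, fun x hx => ?_⟩
    linarith [norm_sub_norm_le a x, norm_sub_rev a x]

variable {m n : ℕ}

section NormalEquations

variable (A E : Matrix (Fin m) (Fin n) ℝ) (b e : EuclideanSpace ℝ (Fin m))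
  (x z : EuclideanSpace ℝ (Fin n))

lemma residual_add_add :
    residual (A + E) (b + e) x = residual A b x + residual E e x := by
  simp only [residual, Matrix.add_mulVec, WithLp.toLp_add]
  abel

lemma residual_eq_add_mulVec_sub :
    (residual A b z).ofLp = (residual A b x).ofLp + A *ᵥ (z - x).ofLp := by
  simp only [residual, WithLp.ofLp_sub, Matrix.mulVec_sub]
  abel

lemma residual_deflation_mul (v : Fin m → ℝ) :
    residual (deflation v * E) (WithLp.toLp 2 (deflation v *ᵥ e.ofLp)) x
      = WithLp.toLp 2 (deflation v *ᵥ (residual E e x).ofLp) := by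
  simp only [residual, WithLp.ofLp_sub, Matrix.mulVec_sub, Matrix.mulVec_mulVec, WithLp.toLp_sub]

lemma isSolution_iff_vecMul_eq_zero :
    IsSolution A b x ↔ (residual A b x).ofLp ᵥ* A = 0 := by
  let T : EuclideanSpace ℝ (Fin n) →ₗ[ℝ] EuclideanSpace ℝ (Fin m) := Matrix.toLpLin 2 2 A
  have hT (z) : ‖residual A b z‖ = ‖b - T z‖ := norm_sub_rev _ _
  have hmin : IsSolution A b x ↔
      ‖b - T x‖ = ⨅ w : (LinearMap.range T : Set (EuclideanSpace ℝ (Fin m))), ‖b - w‖ := by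
    have hbdd : BddBelow (Set.range fun w : (LinearMap.range T : Set (EuclideanSpace ℝ (Fin m))) =>
        ‖b - w‖) :=
      ⟨0, Set.forall_mem_range.2 fun _ => norm_nonneg _⟩
    constructor
    · intro h
      refine le_antisymm (le_ciInf ?_) (ciInf_le hbdd ⟨T x, x, rfl⟩)
      rintro ⟨_, z, rfl⟩
      simpa only [hT] using h z
    · intro h z
      rw [hT, hT, h]
      exact ciInf_le hbdd ⟨T z, z, rfl⟩
  rw [hmin, Submodule.norm_eq_iInf_iff_real_inner_eq_zero _ (LinearMap.mem_range_self T x),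
    ← dotProduct_eq_zero_iff]
  have hinner (z : EuclideanSpace ℝ (Fin n)) :
      inner ℝ (b - T x) (T z) = -((residual A b x).ofLp ᵥ* A ⬝ᵥ z.ofLp) := by
    rw [show b - T x = -residual A b x from (neg_sub _ _).symm, inner_neg_left,
      inner_eq_dotProduct, ← Matrix.dotProduct_mulVec]
    rfl
  simp only [LinearMap.mem_range, forall_exists_index, forall_apply_eq_imp_iff, hinner,
    neg_eq_zero]
  exact ⟨fun h w => h (WithLp.toLp 2 w), fun h z => h z.ofLp⟩

end NormalEquations

section AugmentedNorm

variable (t : ℝ) (E : Matrix (Fin m) (Fin n) ℝ) (e : EuclideanSpace ℝ (Fin m))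

attribute [local instance] Matrix.frobeniusNormedAddCommGroup in
lemma augFrobeniusNorm_nonneg : 0 ≤ augFrobeniusNorm t E e :=
  norm_nonneg _

attribute [local instance] Matrix.frobeniusNormedAddCommGroup in
lemma augFrobeniusNorm_sq :
    augFrobeniusNorm t E e ^ 2 = ∑ i, E i ⬝ᵥ E i + t ^ 2 * ‖e‖ ^ 2 := by
  rw [augFrobeniusNorm, Matrix.frobenius_norm_def, ← Real.sqrt_eq_rpow,
    Real.sq_sqrt (by positivity), EuclideanSpace.real_norm_sq_eq]
  simp [Fintype.sum_sum_type, dotProduct, sq, mul_mul_mul_comm, Finset.sum_add_distrib,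
    Finset.mul_sum]

lemma augFrobeniusNorm_sq_eq_deflation_add {v : Fin m → ℝ} (hv : v = 0 ∨ v ⬝ᵥ v = 1) :
    augFrobeniusNorm t E e ^ 2
      = augFrobeniusNorm t (deflation v * E) (WithLp.toLp 2 (deflation v *ᵥ e.ofLp)) ^ 2
        + (v ᵥ* E) ⬝ᵥ (v ᵥ* E) + t ^ 2 * (v ⬝ᵥ e.ofLp) ^ 2 := by
  rw [augFrobeniusNorm_sq, augFrobeniusNorm_sq, sum_dotProduct_self_deflation_mul hv,
    norm_sq_eq_dotProduct, norm_sq_eq_dotProduct, deflation_mulVec_dotProduct_self hv]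
  ring

end AugmentedNorm

section Weight

variable (θ : ℝ≥0∞) (x : EuclideanSpace ℝ (Fin n))

/-- The number `μ / ‖x‖² = 1 / (‖x‖² + θ⁻²)`, which is the largest `c` such that
`c ‖E x - e‖² ≤ ‖(E, θ e)‖_F²` for all admissible `(E, e)`. -/
noncomputable def weight : ℝ := mu θ x / ‖x‖ ^ 2

lemma mu_nonneg : 0 ≤ mu θ x := by
  unfold mu
  split_ifs <;> positivity

lemma mu_pos {θ : ℝ≥0∞} {x : EuclideanSpace ℝ (Fin n)} (hθ : θ ≠ 0) (hx : x ≠ 0) :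
    0 < mu θ x := by
  unfold mu
  split_ifs with hθ'
  · exact one_pos
  · have := ENNReal.toReal_pos hθ hθ'
    have := norm_pos_iff.2 hx
    positivity

lemma mu_le_one : mu θ x ≤ 1 := by
  unfold mu
  split_ifs
  · exact le_rfl
  · exact div_le_one_of_le₀ (by linarith) (by positivity)

lemma weight_pos {θ : ℝ≥0∞} {x : EuclideanSpace ℝ (Fin n)} (hθ : θ ≠ 0) (hx : x ≠ 0) :
    0 < weight θ x :=
  div_pos (mu_pos hθ hx) (pow_pos (norm_pos_iff.2 hx) 2)

lemma weight_nonneg : 0 ≤ weight θ x :=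
  div_nonneg (mu_nonneg θ x) (sq_nonneg _)

variable {x}

lemma weight_mul_norm_sq (hx : x ≠ 0) : weight θ x * ‖x‖ ^ 2 = mu θ x :=
  div_mul_cancel₀ _ (pow_ne_zero 2 (norm_ne_zero_iff.2 hx))

lemma toReal_sq_mul_one_sub_mu {θ : ℝ≥0∞} (hθ : θ ≠ ∞) (hx : x ≠ 0) :
    θ.toReal ^ 2 * (1 - mu θ x) = weight θ x := by
  have := norm_pos_iff.2 hx
  rw [weight, mu, if_neg hθ]
  field_simp
  ring

lemma toReal_sq_mul_one_sub_mu_sq (hx : x ≠ 0) :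
    θ.toReal ^ 2 * (1 - mu θ x) ^ 2 = weight θ x * (1 - mu θ x) := by
  rcases eq_or_ne θ ∞ with rfl | hθ
  · simp [mu]
  · rw [← toReal_sq_mul_one_sub_mu hθ hx]
    ring

end Weight

section LeastPerturbation

variable (θ : ℝ≥0∞) (x : EuclideanSpace ℝ (Fin n)) (d : EuclideanSpace ℝ (Fin m))

/-- The matrix part `E` of the admissible perturbation `(E, e)` with `E x - e = d` for which
`‖(E, θ e)‖_F` is smallest. -/
noncomputable def leastMatrix : Matrix (Fin m) (Fin n) ℝ :=
  weight θ x • Matrix.vecMulVec d.ofLp x.ofLp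

/-- The right-hand side part `e` of the admissible perturbation `(E, e)` with `E x - e = d` for
which `‖(E, θ e)‖_F` is smallest. -/
noncomputable def leastRhs : EuclideanSpace ℝ (Fin m) :=
  -(1 - mu θ x) • d

lemma leastRhs_top : leastRhs ∞ x d = 0 := by
  simp [leastRhs, mu]

variable {θ x}

lemma residual_leastMatrix_leastRhs (hx : x ≠ 0) :
    residual (leastMatrix θ x d) (leastRhs θ x d) x = d := by
  have hmul : leastMatrix θ x d *ᵥ x.ofLp = mu θ x • d.ofLp := by
    rw [leastMatrix, Matrix.smul_mulVec, Matrix.vecMulVec_mulVec, op_smul_eq_smul, smul_smul,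
      ← norm_sq_eq_dotProduct, weight_mul_norm_sq θ hx]
  rw [residual, hmul, leastRhs, WithLp.toLp_smul]
  module

/-- The difference of `(E, e)` and the least perturbation with the same residual at `x` is
orthogonal to the latter. -/
lemma augFrobeniusNorm_sq_eq_weight_mul_add (hx : x ≠ 0) {E : Matrix (Fin m) (Fin n) ℝ}
    {e : EuclideanSpace ℝ (Fin m)} (he : θ = ∞ → e = 0) (hd : residual E e x = d) :
    augFrobeniusNorm θ.toReal E e ^ 2 = weight θ x * ‖d‖ ^ 2
      + augFrobeniusNorm θ.toReal (E - leastMatrix θ x d) (e - leastRhs θ x d) ^ 2 := by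
  have hX := weight_mul_norm_sq θ hx
  have hrow (i) : E i ⬝ᵥ x.ofLp = d i + e i := by
    simp [← hd, residual, Matrix.mulVec]
  have hcross (i) : θ.toReal ^ 2 * (1 - mu θ x) * e i = weight θ x * e i := by
    rcases eq_or_ne θ ∞ with hθ | hθ
    · simp [he hθ]
    · rw [toReal_sq_mul_one_sub_mu hθ hx]
  have hsq := toReal_sq_mul_one_sub_mu_sq θ hx
  rw [norm_sq_eq_dotProduct] at hX
  simp only [augFrobeniusNorm_sq, EuclideanSpace.real_norm_sq_eq, Finset.mul_sum,
    ← Finset.sum_add_distrib]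
  refine Finset.sum_congr rfl fun i _ => ?_
  have hleastMatrix : (E - leastMatrix θ x d) i = E i - (weight θ x * d i) • x.ofLp := by
    ext j
    simp [leastMatrix, Matrix.vecMulVec_apply, mul_assoc]
  have hleastRhs : (e - leastRhs θ x d) i = e i + (1 - mu θ x) * d i := by
    simp only [leastRhs, PiLp.sub_apply, PiLp.smul_apply, smul_eq_mul]
    ring
  rw [hleastMatrix, hleastRhs]
  simp only [dotProduct_sub, sub_dotProduct, dotProduct_smul, smul_dotProduct, smul_eq_mul,
    dotProduct_comm x.ofLp (E i), hrow]
  linear_combination (-2 * d i) * hcross i - d i ^ 2 * hsq - weight θ x * d i ^ 2 * hX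

lemma weight_mul_norm_sq_residual_le (hx : x ≠ 0) {E : Matrix (Fin m) (Fin n) ℝ}
    {e : EuclideanSpace ℝ (Fin m)} (he : θ = ∞ → e = 0) :
    weight θ x * ‖residual E e x‖ ^ 2 ≤ augFrobeniusNorm θ.toReal E e ^ 2 := by
  rw [augFrobeniusNorm_sq_eq_weight_mul_add _ hx he rfl]
  exact le_add_of_nonneg_right (sq_nonneg _)

lemma augFrobeniusNorm_leastMatrix_leastRhs_sq (hx : x ≠ 0) :
    augFrobeniusNorm θ.toReal (leastMatrix θ x d) (leastRhs θ x d) ^ 2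
      = weight θ x * ‖d‖ ^ 2 := by
  have he : θ = ∞ → leastRhs θ x d = 0 := by
    rintro rfl
    exact leastRhs_top x d
  rw [augFrobeniusNorm_sq_eq_weight_mul_add d hx he (residual_leastMatrix_leastRhs d hx),
    sub_self, sub_self, augFrobeniusNorm_sq]
  simp [dotProduct]

variable {d} {v : Fin m → ℝ}

lemma vecMul_leastMatrix (hvd : v ⬝ᵥ d.ofLp = 0) : v ᵥ* leastMatrix θ x d = 0 := by
  rw [leastMatrix, Matrix.vecMul_smul, Matrix.vecMul_vecMulVec, hvd, zero_smul, smul_zero]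

lemma deflation_mul_leastMatrix (hvd : v ⬝ᵥ d.ofLp = 0) :
    deflation v * leastMatrix θ x d = leastMatrix θ x d := by
  rw [leastMatrix, Matrix.mul_smul, Matrix.mul_vecMulVec, deflation_mulVec, hvd, zero_smul,
    sub_zero]

end LeastPerturbation

section BackwardError

variable (θ : ℝ≥0∞) (A : Matrix (Fin m) (Fin n) ℝ) (b : EuclideanSpace ℝ (Fin m))
  (x : EuclideanSpace ℝ (Fin n))

/-- The quadratic form of the matrix `A Aᵀ - μ r rᵀ / ‖x‖²` whose smallest eigenvalue is `λ_*`. -/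
noncomputable def lambdaStarForm (v : Fin m → ℝ) : ℝ :=
  (v ᵥ* A) ⬝ᵥ (v ᵥ* A) - weight θ x * (v ⬝ᵥ (residual A b x).ofLp) ^ 2

lemma isHermitian_lambdaStar_matrix :
    (A * Aᵀ - (mu θ x / ‖x‖ ^ 2) •
      Matrix.vecMulVec (residual A b x).ofLp (residual A b x).ofLp).IsHermitian := by
  ext i j
  simp [Matrix.vecMulVec_apply, Matrix.mul_apply, mul_comm]

lemma dotProduct_mulVec_eq_lambdaStarForm (v : Fin m → ℝ) :
    v ⬝ᵥ (A * Aᵀ - (mu θ x / ‖x‖ ^ 2) •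
      Matrix.vecMulVec (residual A b x).ofLp (residual A b x).ofLp) *ᵥ v
      = lambdaStarForm θ A b x v := by
  rw [lambdaStarForm, weight, Matrix.sub_mulVec, dotProduct_sub, ← Matrix.mulVec_mulVec,
    Matrix.dotProduct_mulVec, Matrix.mulVec_transpose, Matrix.smul_mulVec,
    Matrix.vecMulVec_mulVec, op_smul_eq_smul, dotProduct_smul, dotProduct_smul,
    dotProduct_comm _ v, smul_eq_mul, smul_eq_mul, ← sq]

lemma lambdaStar_mul_dotProduct_self_le (v : Fin m → ℝ) :
    lambdaStar θ A b x * (v ⬝ᵥ v) ≤ lambdaStarForm θ A b x v := by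
  rw [← dotProduct_mulVec_eq_lambdaStarForm]
  exact lambdaMin_mul_dotProduct_self_le (isHermitian_lambdaStar_matrix θ A b x) v

lemma exists_lambdaStarForm_eq_lambdaStar [NeZero m] :
    ∃ v : Fin m → ℝ, v ⬝ᵥ v = 1 ∧ lambdaStarForm θ A b x v = lambdaStar θ A b x := by
  simp only [← dotProduct_mulVec_eq_lambdaStarForm]
  exact exists_dotProduct_mulVec_eq_lambdaMin (isHermitian_lambdaStar_matrix θ A b x)

variable {v : Fin m → ℝ}

lemma min_lambdaStar_zero_le_lambdaStarForm (hv : v = 0 ∨ v ⬝ᵥ v = 1) :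
    min (lambdaStar θ A b x) 0 ≤ lambdaStarForm θ A b x v := by
  have h := lambdaStar_mul_dotProduct_self_le θ A b x v
  rcases hv with rfl | hv
  · exact min_le_of_right_le (by simpa using h)
  · exact min_le_of_left_le (by simpa only [hv, mul_one] using h)

lemma exists_lambdaStarForm_eq_min_lambdaStar_zero [NeZero m] :
    ∃ v : Fin m → ℝ, (v = 0 ∨ v ⬝ᵥ v = 1) ∧
      lambdaStarForm θ A b x v = min (lambdaStar θ A b x) 0 := by
  rcases le_total (lambdaStar θ A b x) 0 with h | h
  · obtain ⟨v, hv, hvx⟩ := exists_lambdaStarForm_eq_lambdaStar θ A b x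
    exact ⟨v, .inr hv, by rw [hvx, min_eq_left h]⟩
  · exact ⟨0, .inl rfl, by simp [lambdaStarForm, h]⟩

lemma weight_mul_norm_sq_residual_add_lambdaStarForm (hv : v = 0 ∨ v ⬝ᵥ v = 1) :
    weight θ x * ‖residual A b x‖ ^ 2 + lambdaStarForm θ A b x v
      = weight θ x * ‖WithLp.toLp 2 (deflation v *ᵥ (residual A b x).ofLp)‖ ^ 2
        + (v ᵥ* A) ⬝ᵥ (v ᵥ* A) := by
  rw [norm_sq_eq_dotProduct, norm_sq_eq_dotProduct, deflation_mulVec_dotProduct_self hv,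
    lambdaStarForm]
  ring

variable {θ A b x}

/-- If the perturbed residual `s` points along `v`, then deflating by `v` leaves a perturbation
that must cancel the deflated residual, while `vᵀ E = -vᵀ A` by the normal equations. -/
lemma exists_le_sq_of_mem_backwardErrors (hx : x ≠ 0) {η : ℝ}
    (hη : η ∈ backwardErrors θ A b x) :
    ∃ v : Fin m → ℝ, (v = 0 ∨ v ⬝ᵥ v = 1) ∧
      weight θ x * ‖residual A b x‖ ^ 2 + lambdaStarForm θ A b x v ≤ η ^ 2 := by
  obtain ⟨E, e, he, hsol, rfl⟩ := hη
  rw [isSolution_iff_vecMul_eq_zero, residual_add_add] at hsol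
  obtain ⟨k, hv, hdefl⟩ :=
    exists_deflation_mulVec_eq_zero (residual A b x + residual E e x).ofLp
  set v := k • (residual A b x + residual E e x).ofLp with hvdef
  have hvE : v ᵥ* E = -(v ᵥ* A) := by
    rw [eq_neg_iff_add_eq_zero, add_comm, ← Matrix.vecMul_add, hvdef, Matrix.smul_vecMul, hsol,
      smul_zero]
  have hres : ‖residual (deflation v * E) (WithLp.toLp 2 (deflation v *ᵥ e.ofLp)) x‖
      = ‖WithLp.toLp 2 (deflation v *ᵥ (residual A b x).ofLp)‖ := by
    rw [WithLp.ofLp_add, Matrix.mulVec_add, add_comm] at hdefl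
    rw [residual_deflation_mul, eq_neg_of_add_eq_zero_left hdefl, WithLp.toLp_neg, norm_neg]
  have he' : θ = ∞ → WithLp.toLp 2 (deflation v *ᵥ e.ofLp) = 0 := fun hθ => by simp [he hθ]
  refine ⟨v, hv, ?_⟩
  have hbound := weight_mul_norm_sq_residual_le (E := deflation v * E) hx he'
  rw [weight_mul_norm_sq_residual_add_lambdaStarForm θ A b x hv, ← hres,
    augFrobeniusNorm_sq_eq_deflation_add θ.toReal E e hv, hvE, neg_dotProduct_neg]
  have : 0 ≤ θ.toReal ^ 2 * (v ⬝ᵥ e.ofLp) ^ 2 := by positivity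
  linarith

lemma isSolution_add_leastMatrix_sub (hx : x ≠ 0) (hv : v = 0 ∨ v ⬝ᵥ v = 1)
    {d : EuclideanSpace ℝ (Fin m)} (hd : d.ofLp = -(deflation v *ᵥ (residual A b x).ofLp)) :
    IsSolution (A + (leastMatrix θ x d - Matrix.vecMulVec v (v ᵥ* A))) (b + leastRhs θ x d) x := by
  have hvd : v ⬝ᵥ d.ofLp = 0 := by
    rw [hd, dotProduct_neg, dotProduct_deflation_mulVec hv, neg_zero]
  have horth : v ᵥ* (A + (leastMatrix θ x d - Matrix.vecMulVec v (v ᵥ* A))) = 0 := by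
    rw [Matrix.vecMul_add, Matrix.vecMul_sub, vecMul_leastMatrix hvd,
      vecMul_vecMulVec_vecMul hv, zero_sub, add_neg_cancel]
  have hpert : (residual (leastMatrix θ x d - Matrix.vecMulVec v (v ᵥ* A)) (leastRhs θ x d) x).ofLp
      = d.ofLp - ((v ᵥ* A) ⬝ᵥ x.ofLp) • v := by
    conv_rhs => rw [← residual_leastMatrix_leastRhs d hx (θ := θ)]
    simp only [residual, WithLp.ofLp_sub, Matrix.sub_mulVec, Matrix.vecMulVec_mulVec,
      op_smul_eq_smul]
    abel
  have hres : (residual (A + (leastMatrix θ x d - Matrix.vecMulVec v (v ᵥ* A)))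
      (b + leastRhs θ x d) x).ofLp
      = (v ⬝ᵥ (residual A b x).ofLp - (v ᵥ* A) ⬝ᵥ x.ofLp) • v := by
    rw [residual_add_add, WithLp.ofLp_add, hpert, hd, deflation_mulVec]
    module
  rw [isSolution_iff_vecMul_eq_zero, hres, Matrix.smul_vecMul, horth, smul_zero]

lemma augFrobeniusNorm_leastMatrix_sub_sq (hx : x ≠ 0) (hv : v = 0 ∨ v ⬝ᵥ v = 1)
    {d : EuclideanSpace ℝ (Fin m)} (hvd : v ⬝ᵥ d.ofLp = 0) :
    augFrobeniusNorm θ.toReal (leastMatrix θ x d - Matrix.vecMulVec v (v ᵥ* A))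
        (leastRhs θ x d) ^ 2
      = weight θ x * ‖d‖ ^ 2 + (v ᵥ* A) ⬝ᵥ (v ᵥ* A) := by
  have hve : v ⬝ᵥ (leastRhs θ x d).ofLp = 0 := by
    rw [leastRhs, WithLp.ofLp_smul, dotProduct_smul, hvd, smul_zero]
  have hdeflMatrix : deflation v * (leastMatrix θ x d - Matrix.vecMulVec v (v ᵥ* A))
      = leastMatrix θ x d := by
    rw [Matrix.mul_sub, deflation_mul_leastMatrix hvd, Matrix.mul_vecMulVec,
      deflation_mulVec_self hv, Matrix.zero_vecMulVec, sub_zero]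
  have hdeflRhs : deflation v *ᵥ (leastRhs θ x d).ofLp = (leastRhs θ x d).ofLp := by
    rw [deflation_mulVec, hve, zero_smul, sub_zero]
  have hvE : v ᵥ* (leastMatrix θ x d - Matrix.vecMulVec v (v ᵥ* A)) = -(v ᵥ* A) := by
    rw [Matrix.vecMul_sub, vecMul_leastMatrix hvd, vecMul_vecMulVec_vecMul hv, zero_sub]
  rw [augFrobeniusNorm_sq_eq_deflation_add _ _ _ hv, hdeflMatrix, hdeflRhs, hvE, hve,
    WithLp.toLp_ofLp, augFrobeniusNorm_leastMatrix_leastRhs_sq d hx, neg_dotProduct_neg]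
  ring

lemma exists_mem_backwardErrors_sq_eq (hx : x ≠ 0) (hv : v = 0 ∨ v ⬝ᵥ v = 1) :
    ∃ η ∈ backwardErrors θ A b x, 0 ≤ η ∧
      η ^ 2 = weight θ x * ‖residual A b x‖ ^ 2 + lambdaStarForm θ A b x v := by
  let d : EuclideanSpace ℝ (Fin m) :=
    -WithLp.toLp 2 (deflation v *ᵥ (residual A b x).ofLp)
  have hvd : v ⬝ᵥ d.ofLp = 0 := by
    rw [WithLp.ofLp_neg, dotProduct_neg, dotProduct_deflation_mulVec hv, neg_zero]
  have hadm : θ = ∞ → leastRhs θ x d = 0 := by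
    rintro rfl
    exact leastRhs_top x d
  refine ⟨_, ⟨_, _, hadm, isSolution_add_leastMatrix_sub hx hv rfl, rfl⟩,
    augFrobeniusNorm_nonneg _ _ _, ?_⟩
  rw [augFrobeniusNorm_leastMatrix_sub_sq hx hv hvd,
    weight_mul_norm_sq_residual_add_lambdaStarForm θ A b x hv, norm_neg]

lemma gamma_sq_mul_mu (θ : ℝ≥0∞) (A : Matrix (Fin m) (Fin n) ℝ) (b : EuclideanSpace ℝ (Fin m))
    (x : EuclideanSpace ℝ (Fin n)) :
    gamma A b x ^ 2 * mu θ x = weight θ x * ‖residual A b x‖ ^ 2 := by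
  rw [gamma, weight]
  ring

lemma isLeast_backwardErrors [NeZero m] (hx : x ≠ 0) :
    IsLeast (backwardErrors θ A b x)
      √(gamma A b x ^ 2 * mu θ x + min (lambdaStar θ A b x) 0) := by
  constructor
  · obtain ⟨v, hv, hvmin⟩ := exists_lambdaStarForm_eq_min_lambdaStar_zero θ A b x
    obtain ⟨η, hη, hη0, hηsq⟩ := exists_mem_backwardErrors_sq_eq (θ := θ) hx hv
    rwa [gamma_sq_mul_mu, ← hvmin, ← hηsq, Real.sqrt_sq hη0]
  · intro η hη
    obtain ⟨v, hv, hle⟩ := exists_le_sq_of_mem_backwardErrors hx hη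
    obtain ⟨E, e, -, -, rfl⟩ := hη
    rw [Real.sqrt_le_left (augFrobeniusNorm_nonneg _ _ _), gamma_sq_mul_mu]
    linarith [min_lambdaStar_zero_le_lambdaStarForm θ A b x hv]

lemma eta_eq [NeZero m] (hx : x ≠ 0) :
    eta θ A b x = √(gamma A b x ^ 2 * mu θ x + min (lambdaStar θ A b x) 0) :=
  (isLeast_backwardErrors hx).csInf_eq

lemma isLeast_eta [NeZero m] (hx : x ≠ 0) :
    IsLeast (backwardErrors θ A b x) (eta θ A b x) := by
  rw [eta_eq hx]
  exact isLeast_backwardErrors hx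

end BackwardError

section LambdaStarBounds

variable {θ : ℝ≥0∞} {A : Matrix (Fin m) (Fin n) ℝ} {b : EuclideanSpace ℝ (Fin m)}
  {x xls : EuclideanSpace ℝ (Fin n)}

/-- The normal equations make `A x - b` and `r_ls` differ by a vector orthogonal to `r_ls`. -/
lemma lambdaStarForm_residual_of_isSolution (hls : IsSolution A b xls) :
    lambdaStarForm θ A b x (residual A b xls).ofLp
      = -(weight θ x * (‖residual A b xls‖ ^ 2) ^ 2) := by
  rw [isSolution_iff_vecMul_eq_zero] at hls
  rw [lambdaStarForm, residual_eq_add_mulVec_sub A b xls x, dotProduct_add,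
    Matrix.dotProduct_mulVec, hls, zero_dotProduct, zero_dotProduct, add_zero,
    norm_sq_eq_dotProduct, zero_sub]

lemma lambdaStar_le_of_isSolution (hls : IsSolution A b xls) (hrls : residual A b xls ≠ 0) :
    lambdaStar θ A b x ≤ -(weight θ x * ‖residual A b xls‖ ^ 2) := by
  have hpos : 0 < ‖residual A b xls‖ ^ 2 := pow_pos (norm_pos_iff.2 hrls) 2
  have h := lambdaStar_mul_dotProduct_self_le θ A b x (residual A b xls).ofLp
  rw [lambdaStarForm_residual_of_isSolution hls, ← norm_sq_eq_dotProduct] at h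
  refine le_of_mul_le_mul_right (h.trans_eq ?_) hpos
  ring

lemma lambdaStar_nonpos_of_isSolution (hls : IsSolution A b xls) (hrls : residual A b xls ≠ 0) :
    lambdaStar θ A b x ≤ 0 :=
  (lambdaStar_le_of_isSolution hls hrls).trans
    (neg_nonpos.2 (mul_nonneg (weight_nonneg θ x) (sq_nonneg _)))

lemma lambdaStar_neg_of_isSolution (hls : IsSolution A b xls) (hrls : residual A b xls ≠ 0)
    (hθ : θ ≠ 0) (hx : x ≠ 0) : lambdaStar θ A b x < 0 :=
  (lambdaStar_le_of_isSolution hls hrls).trans_lt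
    (neg_neg_of_pos (mul_pos (weight_pos hθ hx) (pow_pos (norm_pos_iff.2 hrls) 2)))

lemma residual_ne_zero_of_isSolution (hls : IsSolution A b xls) (hrls : residual A b xls ≠ 0) :
    residual A b x ≠ 0 :=
  norm_pos_iff.1 ((norm_pos_iff.2 hrls).trans_le (hls x))

lemma sqrt_gamma_sq_mul_mu_add_lambdaStar_le (hr : residual A b x ≠ 0) :
    √(gamma A b x ^ 2 * mu θ x + lambdaStar θ A b x)
      ≤ ‖WithLp.toLp 2 (Aᵀ *ᵥ (residual A b x).ofLp)‖ / ‖residual A b x‖ := by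
  have hpos : 0 < ‖residual A b x‖ ^ 2 := pow_pos (norm_pos_iff.2 hr) 2
  have h := lambdaStar_mul_dotProduct_self_le θ A b x (residual A b x).ofLp
  rw [lambdaStarForm, ← norm_sq_eq_dotProduct] at h
  rw [Real.sqrt_le_left (by positivity), div_pow, le_div_iff₀ hpos, gamma_sq_mul_mu,
    norm_sq_eq_dotProduct (WithLp.toLp 2 (Aᵀ *ᵥ _)), Matrix.mulVec_transpose]
  linarith

lemma lambdaStar_nonneg_of_residual_eq_zero [NeZero m] (hx : x ≠ 0)
    (hrls : residual A b xls = 0) (hclose : ‖x - xls‖ ≤ ‖x‖) : 0 ≤ lambdaStar θ A b x := by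
  obtain ⟨v, -, hv⟩ := exists_lambdaStarForm_eq_lambdaStar θ A b x
  have hres : v ⬝ᵥ (residual A b x).ofLp = (v ᵥ* A) ⬝ᵥ (x - xls).ofLp := by
    rw [residual_eq_add_mulVec_sub A b xls x, hrls, WithLp.ofLp_zero, zero_add,
      Matrix.dotProduct_mulVec]
  have hvA : 0 ≤ (v ᵥ* A) ⬝ᵥ (v ᵥ* A) := dotProduct_self_star_nonneg (v ᵥ* A)
  have hbound :=
    calc weight θ x * (v ⬝ᵥ (residual A b x).ofLp) ^ 2
        ≤ weight θ x * ((v ᵥ* A) ⬝ᵥ (v ᵥ* A) * ‖x - xls‖ ^ 2) := by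
          rw [hres, norm_sq_eq_dotProduct]
          exact mul_le_mul_of_nonneg_left (sq_dotProduct_le _ _) (weight_nonneg θ x)
      _ ≤ weight θ x * ((v ᵥ* A) ⬝ᵥ (v ᵥ* A) * ‖x‖ ^ 2) := by
          have := weight_nonneg θ x
          gcongr
      _ = mu θ x * ((v ᵥ* A) ⬝ᵥ (v ᵥ* A)) := by
          rw [← weight_mul_norm_sq θ hx]
          ring
      _ ≤ (v ᵥ* A) ⬝ᵥ (v ᵥ* A) :=
          mul_le_of_le_one_left hvA (mu_le_one θ x)
  rw [← hv, lambdaStarForm]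
  exact sub_nonneg.2 hbound

lemma eta_eq_of_lambdaStar_nonpos [NeZero m] (hx : x ≠ 0) (h : lambdaStar θ A b x ≤ 0) :
    eta θ A b x = √(gamma A b x ^ 2 * mu θ x + lambdaStar θ A b x) := by
  rw [eta_eq hx, min_eq_left h]

lemma eta_eq_of_lambdaStar_nonneg [NeZero m] (hx : x ≠ 0) (h : 0 ≤ lambdaStar θ A b x) :
    eta θ A b x = gamma A b x * √(mu θ x) := by
  have hγ : 0 ≤ gamma A b x := div_nonneg (norm_nonneg _) (norm_nonneg _)
  rw [eta_eq hx, min_eq_right h, add_zero, Real.sqrt_mul (sq_nonneg _), Real.sqrt_sq hγ]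

end LambdaStarBounds

end LeastSquares

theorem mainTheorem5_general {m n : ℕ} [NeZero m] (A : Matrix (Fin m) (Fin n) ℝ)
    (b : EuclideanSpace ℝ (Fin m)) (θ : ℝ≥0∞)
    (xls : EuclideanSpace ℝ (Fin n)) (hls : LeastSquares.IsSolution A b xls) :
    (LeastSquares.residual A b xls ≠ 0 →
      ∀ x : EuclideanSpace ℝ (Fin n), x ≠ 0 →
        (θ ≠ 0 → LeastSquares.lambdaStar θ A b x < 0) ∧
        IsLeast (LeastSquares.backwardErrors θ A b x) (LeastSquares.eta θ A b x) ∧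
        LeastSquares.eta θ A b x =
          Real.sqrt (LeastSquares.gamma A b x ^ 2 * LeastSquares.mu θ x
            + LeastSquares.lambdaStar θ A b x) ∧
        LeastSquares.eta θ A b x ≤
          ‖(WithLp.toLp 2 (Aᵀ *ᵥ WithLp.ofLp (LeastSquares.residual A b x)) :
            EuclideanSpace ℝ (Fin n))‖ / ‖LeastSquares.residual A b x‖) ∧
    (LeastSquares.residual A b xls = 0 →
      ∃ δ : ℝ, 0 < δ ∧ ∀ x : EuclideanSpace ℝ (Fin n), x ≠ 0 → ‖x - xls‖ < δ →
        0 ≤ LeastSquares.lambdaStar θ A b x ∧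
        IsLeast (LeastSquares.backwardErrors θ A b x) (LeastSquares.eta θ A b x) ∧
        LeastSquares.eta θ A b x =
          LeastSquares.gamma A b x * Real.sqrt (LeastSquares.mu θ x)) := by
  refine ⟨fun hrls x hx => ?_, fun hrls => ?_⟩
  · have heta := LeastSquares.eta_eq_of_lambdaStar_nonpos hx
      (LeastSquares.lambdaStar_nonpos_of_isSolution (θ := θ) hls hrls)
    have hr := LeastSquares.residual_ne_zero_of_isSolution (x := x) hls hrls
    exact ⟨fun hθ => LeastSquares.lambdaStar_neg_of_isSolution hls hrls hθ hx,
      LeastSquares.isLeast_eta hx, heta,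
      heta.trans_le (LeastSquares.sqrt_gamma_sq_mul_mu_add_lambdaStar_le hr)⟩
  · obtain ⟨δ, hδ, hclose⟩ := LeastSquares.exists_pos_forall_norm_sub_le_norm xls
    refine ⟨δ, hδ, fun x hx hxδ => ?_⟩
    have hstar : 0 ≤ LeastSquares.lambdaStar θ A b x :=
      LeastSquares.lambdaStar_nonneg_of_residual_eq_zero hx hrls (hclose x hxδ)
    exact ⟨hstar, LeastSquares.isLeast_eta hx, LeastSquares.eta_eq_of_lambdaStar_nonneg hx hstar⟩

theorem mainTheorem5 {m n : ℕ} (A : Matrix (Fin m) (Fin n) ℝ) (hA : A.rank = n)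
    (b : EuclideanSpace ℝ (Fin m)) (θ : ℝ≥0∞)
    (xls : EuclideanSpace ℝ (Fin n)) (hls : LeastSquares.IsSolution A b xls) :
    (LeastSquares.residual A b xls ≠ 0 →
      ∀ x : EuclideanSpace ℝ (Fin n), x ≠ 0 →
        (θ ≠ 0 → LeastSquares.lambdaStar θ A b x < 0) ∧
        IsLeast (LeastSquares.backwardErrors θ A b x) (LeastSquares.eta θ A b x) ∧
        LeastSquares.eta θ A b x =
          Real.sqrt (LeastSquares.gamma A b x ^ 2 * LeastSquares.mu θ x
            + LeastSquares.lambdaStar θ A b x) ∧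
        LeastSquares.eta θ A b x ≤
          ‖(WithLp.toLp 2 (Aᵀ *ᵥ WithLp.ofLp (LeastSquares.residual A b x)) :
            EuclideanSpace ℝ (Fin n))‖ / ‖LeastSquares.residual A b x‖) ∧
    (LeastSquares.residual A b xls = 0 →
      ∃ δ : ℝ, 0 < δ ∧ ∀ x : EuclideanSpace ℝ (Fin n), x ≠ 0 → ‖x - xls‖ < δ →
        0 ≤ LeastSquares.lambdaStar θ A b x ∧
        IsLeast (LeastSquares.backwardErrors θ A b x) (LeastSquares.eta θ A b x) ∧
        LeastSquares.eta θ A b x =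
          LeastSquares.gamma A b x * Real.sqrt (LeastSquares.mu θ x)) := by
  rcases eq_zero_or_neZero m with rfl | _
  · obtain rfl : n = 0 := Nat.le_zero.1 (hA ▸ A.rank_le_height)
    exact ⟨fun h => absurd (Subsingleton.elim _ _) h,
      fun _ => ⟨1, one_pos, fun x hx => absurd (Subsingleton.elim x 0) hx⟩⟩
  · exact mainTheorem5_general A b θ xls hls
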